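/- Theorem. A pair of $(0,1)$ matrices $A\neq B$ of the same size with $AA^T=BB^T$ and $A^TA=B^TB$ is called a pair of Gram mates. A $(0,1,-1)$ matrix $E$ all of whose row sums and column sums are zero is called realizable if there is a $(0,1)$ matrix $A$ such that $A$ and $A+E$ are Gram mates. Let $a,b,c,d,e,f,k,l,p,q,r,s$ be nonnegative integers such that $a+b$, $c+d$, $e+f$, $k+l$, $p+q$ and $r+s$ are positive, and let $$E=\begin{bmatrix} J_{k,a} & -J_{k,b} & J_{k,c} & -J_{k,d} & 0 & 0 \\ -J_{l,a} & J_{l,b} & -J_{l,c} & J_{l,d} & 0 & 0 \\ J_{p,a} & -J_{p,b} & 0 & 0 & J_{p,e} & -J_{p,f} \\ -J_{q,a} & J_{q,b} & 0 & 0 & -J_{q,e} & J_{q,f} \\ 0 & 0 & J_{r,c} & -J_{r,d} & -J_{r,e} & J_{r,f} \\ 0 & 0 & -J_{s,c} & J_{s,d} & J_{s,e} & -J_{s,f} \end{bmatrix},$$ where $J_{m,n}$ denotes the $m\times n$ all ones matrix (blocks with an index $0$ are absent). Assume that every row sum and every column sum of $E$ is zero. Then $E$ is realizable if and only if one of the following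 conditions holds: (i) $a+b$, $c+d$, $e+f$, $k+l$, $p+q$ and $r+s$ are all even; (ii) $a+b$, $c+d$ and $e+f$ are all odd, or $k+l$, $p+q$ and $r+s$ are all odd; and, moreover, $\frac{e+f}{k+l}=\frac{c+d}{p+q}=\frac{a+b}{r+s}$. -/

import Mathlib

open scoped Matrix

/-- A matrix all of whose entries are `0` or `1`. -/
def IsZeroOneMatrix {m n : Type*} (A : Matrix m n ℤ) : Prop :=
  ∀ i j, A i j = 0 ∨ A i j = 1

/-- `A` and `B` are Gram mates: distinct `(0,1)` matrices of the same size with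
`A Aᵀ = B Bᵀ` and `Aᵀ A = Bᵀ B`. -/
def AreGramMates {m n : Type*} [Fintype m] [Fintype n] (A B : Matrix m n ℤ) : Prop :=
  IsZeroOneMatrix A ∧ IsZeroOneMatrix B ∧ A * Aᵀ = B * Bᵀ ∧ Aᵀ * A = Bᵀ * B ∧ A ≠ B

/-- `E` is realizable (with respect to Gram mates): there is a pair of Gram mates `A` and `A + E`.
The notion is used for `(0,1,-1)` matrices `E` with zero row sums and zero column sums. -/
def IsRealizable {m n : Type*} [Fintype m] [Fintype n] (E : Matrix m n ℤ) : Prop :=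
  ∃ A : Matrix m n ℤ, AreGramMates A (A + E)

/-- The index set of six consecutive blocks of sizes `w 0, …, w 5`: the pair `⟨i, t⟩` is the
`t`-th index of the `i`-th block. Blocks of size `0` are allowed. -/
abbrev BlockIndex (w : Fin 6 → ℕ) : Type := Σ i : Fin 6, Fin (w i)

/-- The sign pattern of the blocks of a matrix of form (M5). -/
def signPatternM5 : Matrix (Fin 6) (Fin 6) ℤ :=
  !![ 1, -1,  1, -1,  0,  0;
     -1,  1, -1,  1,  0,  0;
      1, -1,  0,  0,  1, -1;
     -1,  1,  0,  0, -1,  1;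
      0,  0,  1, -1, -1,  1;
      0,  0, -1,  1,  1, -1]

/-- The block matrix of form (M5) with row blocks of sizes `k, l, p, q, r, s` and column blocks of
sizes `a, b, c, d, e, f`: its `(i, j)` block is the all ones matrix `J`, its negative `-J`, or the
zero matrix, according to the `(i, j)` entry of the sign pattern. -/
def matrixM5 (k l p q r s a b c d e f : ℕ) :
    Matrix (BlockIndex ![k, l, p, q, r, s]) (BlockIndex ![a, b, c, d, e, f]) ℤ :=
  Matrix.of fun x y => signPatternM5 x.1 y.1

/-!
Let `E` be a `(0,1,-1)` matrix with zero row and column sums, and let `F = A + (A + E) - J`. The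
Gram conditions for `A` and `A + E` say that `F * Eᵀ` and `Fᵀ * E` are skew-symmetric, and `A` and
`A + E` are `(0,1)` matrices exactly when `F` has entries `±1` where `E` vanishes and `0` elsewhere.

After changing the signs of rows and columns, a matrix of form (M5) is a blow-up of the
skew-symmetric matrix of the cyclic tournament on three vertices. Its zero blocks are the diagonal
ones, and skew-symmetry of `F * Eᵀ` means that, after the same sign changes, any two rows of `F` in
different row blocks have the same sum, so that all rows do. So `E` is realizable if and only if
there are `±1` matrices of the shapes of the zero blocks which all have the same row sum `x` and the
same column sum `y`.

The number `x` has the parity of the widths of the zero blocks, `y` that of their heights, and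
`height * x = width * y`; unless `x` and `y` are both even, the zero blocks thus have proportional
shapes. Conversely, a circulant matrix with alternating first column, blown up by an all ones
matrix, provides the required `±1` matrices.
-/

section GramCondition

variable {m n : Type*}

/-- The matrix `A + (A + E) - J`, where `J` is the all ones matrix: the sum of the pair `A`,
`A + E`, normalized to have entries in `{-1, 0, 1}` if the pair consists of `(0,1)` matrices. -/
def centeredSum (A E : Matrix m n ℤ) : Matrix m n ℤ := A + (A + E) - Matrix.of fun _ _ => 1

/-- `F` is a sign complement of `E` if every entry vanishes in exactly one of the two matrices and
is `1` or `-1` in the other. -/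
def IsSignComplement (E F : Matrix m n ℤ) : Prop :=
  ∀ i j, (E i j = 0 ∧ IsUnit (F i j)) ∨ (IsUnit (E i j) ∧ F i j = 0)

theorem transpose_centeredSum (A E : Matrix m n ℤ) :
    (centeredSum A E)ᵀ = centeredSum Aᵀ Eᵀ := rfl

theorem isSignComplement_centeredSum_iff {A E : Matrix m n ℤ} :
    IsSignComplement E (centeredSum A E) ↔ IsZeroOneMatrix A ∧ IsZeroOneMatrix (A + E) := by
  simp only [IsSignComplement, IsZeroOneMatrix, ← forall_and]
  refine forall₂_congr fun i j => ?_
  simp only [centeredSum, Matrix.sub_apply, Matrix.add_apply, Matrix.of_apply, Int.isUnit_iff]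
  omega

theorem IsSignComplement.exists_centeredSum_eq {E F : Matrix m n ℤ} (h : IsSignComplement E F) :
    ∃ A, centeredSum A E = F := by
  refine ⟨Matrix.of fun i j => (1 + F i j - E i j) / 2, ?_⟩
  ext i j
  have hij := h i j
  simp only [Int.isUnit_iff] at hij
  simp only [centeredSum, Matrix.sub_apply, Matrix.add_apply, Matrix.of_apply]
  omega

theorem mul_transpose_self_eq_iff [Fintype n] {A E : Matrix m n ℤ} (hrow : E *ᵥ 1 = 0) :
    A * Aᵀ = (A + E) * (A + E)ᵀ ↔ centeredSum A E * Eᵀ + E * (centeredSum A E)ᵀ = 0 := by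
  have hEJ : E * (Matrix.of fun _ _ => 1 : Matrix m n ℤ)ᵀ = 0 := by
    ext i i'
    simpa [Matrix.mul_apply, Matrix.mulVec, dotProduct] using congrFun hrow i
  have hJE : (Matrix.of fun _ _ => 1 : Matrix m n ℤ) * Eᵀ = 0 := by
    rw [← Matrix.transpose_eq_zero, Matrix.transpose_mul, Matrix.transpose_transpose, hEJ]
  have expand : centeredSum A E * Eᵀ + E * (centeredSum A E)ᵀ =
      (2 : ℤ) • ((A + E) * (A + E)ᵀ - A * Aᵀ) := by
    simp only [centeredSum, Matrix.transpose_sub, Matrix.transpose_add, Matrix.add_mul,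
      Matrix.sub_mul, Matrix.mul_add, Matrix.mul_sub, hJE, hEJ, two_smul]
    abel
  rw [expand]
  simp [← Matrix.ext_iff, sub_eq_zero, eq_comm]

theorem isRealizable_iff_exists_isSignComplement [Fintype m] [Fintype n] {E : Matrix m n ℤ}
    (hE : E ≠ 0) (hrow : E *ᵥ 1 = 0) (hcol : 1 ᵥ* E = 0) :
    IsRealizable E ↔
      ∃ F, IsSignComplement E F ∧ F * Eᵀ + E * Fᵀ = 0 ∧ Fᵀ * E + Eᵀ * F = 0 := by
  have gramMates_iff (A : Matrix m n ℤ) : AreGramMates A (A + E) ↔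
      IsSignComplement E (centeredSum A E) ∧
        centeredSum A E * Eᵀ + E * (centeredSum A E)ᵀ = 0 ∧
        (centeredSum A E)ᵀ * E + Eᵀ * centeredSum A E = 0 := by
    have hcol_gram := mul_transpose_self_eq_iff (A := Aᵀ) (E := Eᵀ)
      (by rw [Matrix.mulVec_transpose, hcol])
    simp only [← transpose_centeredSum, ← Matrix.transpose_add, Matrix.transpose_transpose]
      at hcol_gram
    rw [AreGramMates, isSignComplement_centeredSum_iff, mul_transpose_self_eq_iff hrow, hcol_gram]
    simp [hE, and_assoc]
  constructor
  · rintro ⟨A, hA⟩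
    exact ⟨centeredSum A E, (gramMates_iff A).1 hA⟩
  · rintro ⟨F, hF⟩
    obtain ⟨A, rfl⟩ := hF.1.exists_centeredSum_eq
    exact ⟨A, (gramMates_iff A).2 hF⟩

end GramCondition

section SignMatrix

variable {m n m' n' : Type*} [Fintype m] [Fintype n] [Fintype m'] [Fintype n']
  {x y x' y' : ℤ} {G : Matrix m n ℤ} {H : Matrix m' n' ℤ}

/-- `G` is a matrix with entries `1` and `-1`, all of whose row sums are `x` and all of whose column
sums are `y`. -/
structure IsSignMatrix (G : Matrix m n ℤ) (x y : ℤ) : Prop where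
  isUnit : ∀ i j, IsUnit (G i j)
  row_sum : ∀ i, ∑ j, G i j = x
  col_sum : ∀ j, ∑ i, G i j = y

theorem even_sum_isUnit_iff {f : n → ℤ} (hf : ∀ j, IsUnit (f j)) :
    Even (∑ j, f j) ↔ Even (Fintype.card n) := by
  have h : Even (∑ j, (f j + 1)) := by
    refine Finset.even_sum _ fun j _ => ?_
    rcases Int.isUnit_iff.1 (hf j) with h | h <;> simp [h]
  simpa [Finset.sum_add_distrib, Int.even_add] using h

namespace IsSignMatrix

theorem transpose (hG : IsSignMatrix G x y) : IsSignMatrix Gᵀ y x :=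
  ⟨fun j i => hG.isUnit i j, hG.col_sum, hG.row_sum⟩

theorem even_row_sum_iff [Nonempty m] (hG : IsSignMatrix G x y) :
    Even x ↔ Even (Fintype.card n) := by
  obtain ⟨i⟩ := ‹Nonempty m›
  rw [← hG.row_sum i, even_sum_isUnit_iff (hG.isUnit i)]

theorem even_col_sum_iff [Nonempty n] (hG : IsSignMatrix G x y) :
    Even y ↔ Even (Fintype.card m) :=
  hG.transpose.even_row_sum_iff

theorem card_mul_row_sum (hG : IsSignMatrix G x y) :
    (Fintype.card m : ℤ) * x = Fintype.card n * y := by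
  simpa [hG.row_sum, hG.col_sum] using Finset.sum_comm (s := .univ) (t := .univ) (f := G)

theorem submatrix (hG : IsSignMatrix G x y) (e : m' ≃ m) (e' : n' ≃ n) :
    IsSignMatrix (G.submatrix e e') x y where
  isUnit i j := hG.isUnit (e i) (e' j)
  row_sum i := (e'.sum_comp _).trans (hG.row_sum (e i))
  col_sum j := (e.sum_comp fun i => G i (e' j)).trans (hG.col_sum (e' j))

theorem kronecker (hG : IsSignMatrix G x y) (hH : IsSignMatrix H x' y') :
    IsSignMatrix (Matrix.kronecker G H) (x * x') (y * y') where
  isUnit i j := (hG.isUnit i.1 j.1).mul (hH.isUnit i.2 j.2)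
  row_sum i := by
    simp [Fintype.sum_prod_type, ← Finset.mul_sum, ← Finset.sum_mul, hG.row_sum, hH.row_sum]
  col_sum j := by
    simp [Fintype.sum_prod_type, ← Finset.mul_sum, ← Finset.sum_mul, hG.col_sum, hH.col_sum]

theorem circulant [AddGroup m] {f : m → ℤ} (hf : ∀ i, IsUnit (f i)) :
    IsSignMatrix (Matrix.circulant f) (∑ i, f i) (∑ i, f i) where
  isUnit i j := hf (i - j)
  row_sum i := (Equiv.subLeft i).sum_comp f
  col_sum j := (Equiv.subRight j).sum_comp f

theorem allOnes : IsSignMatrix (Matrix.of fun _ _ => 1 : Matrix m n ℤ)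
    (Fintype.card n) (Fintype.card m) where
  isUnit _ _ := isUnit_one
  row_sum _ := by simp
  col_sum _ := by simp

end IsSignMatrix

theorem exists_isSignMatrix_of_card_eq_mul {g s t : ℕ} [NeZero g] (hm : Fintype.card m = g * s)
    (hn : Fintype.card n = g * t) :
    ∃ G : Matrix m n ℤ,
      IsSignMatrix G ((if Even g then 0 else 1) * t) ((if Even g then 0 else 1) * s) := by
  have alternating : ∑ z : Fin g, (-1 : ℤ) ^ (z : ℕ) = if Even g then 0 else 1 := by
    rw [Fin.sum_univ_eq_sum_range fun z => (-1 : ℤ) ^ z, neg_one_geom_sum]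
  have hC := IsSignMatrix.circulant fun z : Fin g => isUnit_neg_one.pow (M := ℤ) (z : ℕ)
  have hCJ := hC.kronecker (IsSignMatrix.allOnes (m := Fin s) (n := Fin t))
  rw [alternating, Fintype.card_fin, Fintype.card_fin] at hCJ
  exact ⟨_, hCJ.submatrix ((Fintype.equivFinOfCardEq hm).trans finProdFinEquiv.symm)
    ((Fintype.equivFinOfCardEq hn).trans finProdFinEquiv.symm)⟩

theorem exists_isSignMatrix_zero_zero (hm : Even (Fintype.card m)) (hn : Even (Fintype.card n)) :
    ∃ G : Matrix m n ℤ, IsSignMatrix G 0 0 := by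
  obtain ⟨s, hs⟩ := hm.two_dvd
  obtain ⟨t, ht⟩ := hn.two_dvd
  simpa using exists_isSignMatrix_of_card_eq_mul hs ht

theorem exists_isSignMatrix_of_odd {g s t : ℕ} (hg : Odd g) (hm : Fintype.card m = g * s)
    (hn : Fintype.card n = g * t) : ∃ G : Matrix m n ℤ, IsSignMatrix G t s := by
  have : NeZero g := ⟨hg.pos.ne'⟩
  simpa [Nat.not_even_iff_odd.2 hg] using exists_isSignMatrix_of_card_eq_mul hm hn

end SignMatrix

section CommonSums

theorem mul_eq_mul_of_mul_eq_mul {R : Type*} [CommRing R] [NoZeroDivisors R] {p p' q q' x y : R}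
    (hxy : x ≠ 0 ∨ y ≠ 0) (h : p * x = q * y) (h' : p' * x = q' * y) : q * p' = q' * p := by
  rcases hxy with hx | hy
  · exact mul_right_cancel₀ hx (by linear_combination q * h' - q' * h)
  · exact mul_right_cancel₀ hy (by linear_combination p * h' - p' * h)

theorem exists_common_factors {ι : Type*} {P Q : ι → ℕ} {r₀ : ι} (hpos : 0 < P r₀)
    (h : ∀ r, Q r * P r₀ = Q r₀ * P r) :
    ∃ s t : ℕ, ∀ r, ∃ g, P r = g * s ∧ Q r = g * t := by
  obtain ⟨g₀, s, t, hg₀, hcoprime, hs, ht⟩ :=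
    Nat.exists_coprime' (m := P r₀) (n := Q r₀) (Nat.gcd_pos_of_pos_left _ hpos)
  have hs_pos : 0 < s := Nat.pos_of_mul_pos_right (hs ▸ hpos)
  refine ⟨s, t, fun r => ?_⟩
  have hst : t * P r = Q r * s := by
    refine Nat.eq_of_mul_eq_mul_right hg₀ ?_
    linear_combination -h r + Q r * hs - P r * ht
  obtain ⟨g, hg⟩ : s ∣ P r := hcoprime.dvd_of_dvd_mul_left (hst ▸ dvd_mul_left s (Q r))
  refine ⟨g, hg.trans (mul_comm s g), Nat.eq_of_mul_eq_mul_right hs_pos ?_⟩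
  linear_combination -hst + t * hg

variable {ι : Type*} {P Q : ι → Type*} [∀ r, Fintype (P r)] [∀ r, Fintype (Q r)]
  [∀ r, Nonempty (P r)]

theorem exists_forall_isSignMatrix_of_proportional
    (hodd : (∀ r, Odd (Fintype.card (P r))) ∨ ∀ r, Odd (Fintype.card (Q r)))
    (hprop : ∀ r t, Fintype.card (Q r) * Fintype.card (P t) =
      Fintype.card (Q t) * Fintype.card (P r)) :
    ∃ x y : ℤ, ∀ r, ∃ G : Matrix (P r) (Q r) ℤ, IsSignMatrix G x y := by
  rcases isEmpty_or_nonempty ι with _ | ⟨⟨r₀⟩⟩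
  · exact ⟨0, 0, isEmptyElim⟩
  obtain ⟨s, t, hst⟩ := exists_common_factors (P := fun r => Fintype.card (P r))
    (Q := fun r => Fintype.card (Q r)) Fintype.card_pos fun r => hprop r r₀
  refine ⟨t, s, fun r => ?_⟩
  obtain ⟨g, hP, hQ⟩ := hst r
  have hg : Odd g := hodd.elim (fun h => Nat.Odd.of_mul_left (hP ▸ h r))
    fun h => Nat.Odd.of_mul_left (hQ ▸ h r)
  exact exists_isSignMatrix_of_odd hg hP hQ

theorem exists_forall_isSignMatrix_iff [∀ r, Nonempty (Q r)] :
    (∃ x y : ℤ, ∀ r, ∃ G : Matrix (P r) (Q r) ℤ, IsSignMatrix G x y) ↔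
      ((∀ r, Even (Fintype.card (P r))) ∧ ∀ r, Even (Fintype.card (Q r))) ∨
        (((∀ r, Odd (Fintype.card (P r))) ∨ ∀ r, Odd (Fintype.card (Q r))) ∧
          ∀ r t, Fintype.card (Q r) * Fintype.card (P t) =
            Fintype.card (Q t) * Fintype.card (P r)) := by
  constructor
  · rintro ⟨x, y, h⟩
    choose G hG using h
    by_cases heven : Even x ∧ Even y
    · exact Or.inl ⟨fun r => (hG r).even_col_sum_iff.1 heven.2,
        fun r => (hG r).even_row_sum_iff.1 heven.1⟩
    have hxy : x ≠ 0 ∨ y ≠ 0 := by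
      by_contra! h
      exact heven (by simp [h])
    refine Or.inr ⟨?_, fun r t => ?_⟩
    · simp only [← Nat.not_even_iff_odd, ← (hG _).even_row_sum_iff, ← (hG _).even_col_sum_iff]
      exact (not_and_or.1 heven).symm.imp (fun h _ => h) fun h _ => h
    · exact_mod_cast mul_eq_mul_of_mul_eq_mul hxy (hG r).card_mul_row_sum (hG t).card_mul_row_sum
  · rintro (⟨hP, hQ⟩ | ⟨hodd, hprop⟩)
    · exact ⟨0, 0, fun r => exists_isSignMatrix_zero_zero (hP r) (hQ r)⟩
    · exact exists_forall_isSignMatrix_of_proportional hodd hprop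

end CommonSums

section Fiber

variable {ι n : Type*} [DecidableEq ι] [Fintype n] {σ : n → ι}

theorem sum_fiber_eq_sum {f : n → ℤ} {r : ι} (hf : ∀ j, σ j ≠ r → f j = 0) :
    ∑ j : {j // σ j = r}, f j = ∑ j, f j :=
  Fintype.sum_of_injective _ Subtype.val_injective _ _ (by simpa using hf) fun _ => rfl

theorem surjective_of_card_fiber_pos (h : ∀ r, 0 < Fintype.card {j // σ j = r}) :
    σ.Surjective :=
  fun r => nonempty_subtype.1 (Fintype.card_pos_iff.1 (h r))

theorem card_fiber_sigma_fst {κ : Type*} [Fintype κ] (φ : κ → ι) (w : κ → ℕ) (r : ι) :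
    Fintype.card {z : Σ i, Fin (w i) // φ z.1 = r} = ∑ i, if φ i = r then w i else 0 := by
  rw [Fintype.card_subtype, Finset.card_filter, Fintype.sum_sigma]
  exact Finset.sum_congr rfl fun i _ => by split_ifs <;> simp

end Fiber

section BlockSignMatrix

variable {ι m n : Type*} [Fintype m] [Fintype n] {ρ : m → ι} {σ : n → ι} {x y : ℤ}

/-- `G` is block diagonal with respect to the block labels `ρ` of the rows and `σ` of the columns,
its diagonal blocks have entries `1` and `-1`, its row sums are `x` and its column sums are `y`. -/
structure IsBlockSignMatrix (ρ : m → ι) (σ : n → ι) (G : Matrix m n ℤ) (x y : ℤ) : Prop where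
  isUnit : ∀ i j, ρ i = σ j → IsUnit (G i j)
  eq_zero : ∀ i j, ρ i ≠ σ j → G i j = 0
  row_sum : ∀ i, ∑ j, G i j = x
  col_sum : ∀ j, ∑ i, G i j = y

variable [DecidableEq ι]

theorem IsBlockSignMatrix.isSignMatrix_fiber {G : Matrix m n ℤ}
    (hG : IsBlockSignMatrix ρ σ G x y) (r : ι) :
    IsSignMatrix
      (G.submatrix (Subtype.val : {i // ρ i = r} → m) (Subtype.val : {j // σ j = r} → n))
      x y where
  isUnit i j := hG.isUnit i j (i.2.trans j.2.symm)
  row_sum i := (sum_fiber_eq_sum fun j hj => hG.eq_zero i j (i.2.trans_ne hj.symm)).trans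
    (hG.row_sum i)
  col_sum j := (sum_fiber_eq_sum fun i hi => hG.eq_zero i j (hi.trans_eq j.2.symm)).trans
    (hG.col_sum j)

theorem exists_isBlockSignMatrix_iff :
    (∃ G, IsBlockSignMatrix ρ σ G x y) ↔
      ∀ r, ∃ G : Matrix {i // ρ i = r} {j // σ j = r} ℤ, IsSignMatrix G x y := by
  refine ⟨fun ⟨G, hG⟩ r => ⟨_, hG.isSignMatrix_fiber r⟩, fun h => ?_⟩
  choose G hG using h
  let H : Matrix m n ℤ := fun i j => if hij : σ j = ρ i then G (ρ i) ⟨i, rfl⟩ ⟨j, hij⟩ else 0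
  have H_fiber (r : ι) (i : {i // ρ i = r}) (j : {j // σ j = r}) : H i j = G r i j := by
    obtain ⟨i, rfl⟩ := i
    exact dif_pos j.2
  have H_eq_zero (i : m) (j : n) (hij : ρ i ≠ σ j) : H i j = 0 := dif_neg hij.symm
  refine ⟨H, fun i j hij => ?_, H_eq_zero, fun i => ?_, fun j => ?_⟩
  · rw [H_fiber (σ j) ⟨i, hij⟩ ⟨j, rfl⟩]
    exact (hG _).isUnit _ _
  · rw [← (hG (ρ i)).row_sum ⟨i, rfl⟩, ← sum_fiber_eq_sum fun j hj => H_eq_zero i j hj.symm]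
    exact Finset.sum_congr rfl fun j _ => H_fiber (ρ i) ⟨i, rfl⟩ j
  · rw [← (hG (σ j)).col_sum ⟨j, rfl⟩, ← sum_fiber_eq_sum fun i hi => H_eq_zero i j hi]
    exact Finset.sum_congr rfl fun i _ => H_fiber (σ j) i ⟨j, rfl⟩

end BlockSignMatrix

section SignedBlowup

variable {ι m n : Type*} {K : Matrix ι ι ℤ} {ρ : m → ι} {σ : n → ι} {u : m → ℤˣ} {v : n → ℤˣ}
  {F : Matrix m n ℤ}

/-- `K` is the skew Seidel matrix of a tournament: it is skew-symmetric and all its entries off the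
diagonal are `1` or `-1`. -/
structure IsSkewSeidel (K : Matrix ι ι ℤ) : Prop where
  transpose_eq_neg : Kᵀ = -K
  isUnit_of_ne : ∀ r t, r ≠ t → IsUnit (K r t)

namespace IsSkewSeidel

theorem apply_comm (hK : IsSkewSeidel K) (r t : ι) : K t r = -K r t :=
  congrFun₂ hK.transpose_eq_neg r t

theorem apply_self (hK : IsSkewSeidel K) (r : ι) : K r r = 0 :=
  self_eq_neg.1 (hK.apply_comm r r)

theorem transpose (hK : IsSkewSeidel K) : IsSkewSeidel Kᵀ where
  transpose_eq_neg := by rw [hK.transpose_eq_neg, Matrix.transpose_neg, hK.transpose_eq_neg]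
  isUnit_of_ne r t h := hK.isUnit_of_ne t r h.symm

end IsSkewSeidel

/-- The matrix obtained from `F` by multiplying the rows by the signs `u` and the columns by the
signs `v`. -/
def signTwist (u : m → ℤˣ) (v : n → ℤˣ) (F : Matrix m n ℤ) : Matrix m n ℤ :=
  Matrix.of fun i j => u i * v j * F i j

theorem transpose_signTwist : (signTwist u v F)ᵀ = signTwist v u Fᵀ := by
  ext j i
  simp [signTwist, mul_comm (u i : ℤ)]

theorem signTwist_involutive (u : m → ℤˣ) (v : n → ℤˣ) : (signTwist u v).Involutive := by
  intro F
  ext i j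
  simp only [signTwist, Matrix.of_apply]
  linear_combination F i j * v j * v j * Int.units_coe_mul_self (u i) +
    F i j * Int.units_coe_mul_self (v j)

theorem isUnit_signTwist_apply_iff {i : m} {j : n} :
    IsUnit (signTwist u v F i j) ↔ IsUnit (F i j) := by
  simp [signTwist]

theorem signTwist_apply_eq_zero_iff {i : m} {j : n} : signTwist u v F i j = 0 ↔ F i j = 0 := by
  simp [signTwist]

/-- The block matrix obtained from `K` by replacing its `(r, t)` entry by a constant block, with
rows labelled `r` by `ρ` and columns labelled `t` by `σ`, and then multiplying the rows by the signs
`u` and the columns by the signs `v`. -/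
def signedBlowup (K : Matrix ι ι ℤ) (ρ : m → ι) (σ : n → ι) (u : m → ℤˣ) (v : n → ℤˣ) :
    Matrix m n ℤ :=
  signTwist u v (K.submatrix ρ σ)

theorem transpose_signedBlowup :
    (signedBlowup K ρ σ u v)ᵀ = signedBlowup Kᵀ σ ρ v u := by
  rw [signedBlowup, transpose_signTwist, Matrix.transpose_submatrix, signedBlowup]

theorem isUnit_signedBlowup_apply (hK : IsSkewSeidel K) {i : m} {j : n} (h : ρ i ≠ σ j) :
    IsUnit (signedBlowup K ρ σ u v i j) :=
  isUnit_signTwist_apply_iff.2 (hK.isUnit_of_ne _ _ h)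

theorem signedBlowup_apply_eq_zero (hK : IsSkewSeidel K) {i : m} {j : n} (h : ρ i = σ j) :
    signedBlowup K ρ σ u v i j = 0 :=
  signTwist_apply_eq_zero_iff.2 (by simp [h, hK.apply_self])

theorem signedBlowup_ne_zero [Nontrivial ι] (hK : IsSkewSeidel K) (hρ : ρ.Surjective)
    (hσ : σ.Surjective) : signedBlowup K ρ σ u v ≠ 0 := by
  obtain ⟨r, t, hrt⟩ := exists_pair_ne ι
  obtain ⟨i, rfl⟩ := hρ r
  obtain ⟨j, rfl⟩ := hσ t
  intro h
  exact (isUnit_signedBlowup_apply hK hrt).ne_zero (congrFun₂ h i j)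

theorem isSignComplement_signedBlowup_iff (hK : IsSkewSeidel K) :
    IsSignComplement (signedBlowup K ρ σ u v) F ↔
      (∀ i j, ρ i = σ j → IsUnit (F i j)) ∧ ∀ i j, ρ i ≠ σ j → F i j = 0 := by
  simp only [IsSignComplement, ← forall_and]
  refine forall₂_congr fun i j => ?_
  by_cases h : ρ i = σ j
  · simp [h, signedBlowup_apply_eq_zero hK h]
  · simp [h, isUnit_signedBlowup_apply hK h, (isUnit_signedBlowup_apply hK h).ne_zero]

theorem mul_transpose_signedBlowup_apply [Fintype n] (hF : ∀ i j, ρ i ≠ σ j → F i j = 0)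
    (i i' : m) :
    (F * (signedBlowup K ρ σ u v)ᵀ) i i' =
      u i * u i' * K (ρ i') (ρ i) * ∑ j, signTwist u v F i j := by
  rw [Matrix.mul_apply, Finset.mul_sum]
  refine Finset.sum_congr rfl fun j _ => ?_
  by_cases h : ρ i = σ j
  · simp only [Matrix.transpose_apply, signedBlowup, signTwist, Matrix.of_apply,
      Matrix.submatrix_apply, h]
    linear_combination (-(F i j * u i' * v j * K (ρ i') (σ j))) * Int.units_coe_mul_self (u i)
  · simp only [signTwist, Matrix.of_apply, hF i j h, zero_mul, mul_zero]

theorem mul_transpose_signedBlowup_skew_iff [Fintype n] [Nontrivial ι] (hK : IsSkewSeidel K)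
    (hρ : ρ.Surjective) (hF : ∀ i j, ρ i ≠ σ j → F i j = 0) :
    F * (signedBlowup K ρ σ u v)ᵀ + signedBlowup K ρ σ u v * Fᵀ = 0 ↔
      ∃ x : ℤ, ∀ i, ∑ j, signTwist u v F i j = x := by
  set R : m → ℤ := fun i => ∑ j, signTwist u v F i j
  have entry (i i' : m) :
      (F * (signedBlowup K ρ σ u v)ᵀ + signedBlowup K ρ σ u v * Fᵀ) i i' =
        u i * u i' * K (ρ i') (ρ i) * (R i - R i') := by
    rw [← Matrix.transpose_transpose (signedBlowup K ρ σ u v * Fᵀ), Matrix.transpose_mul,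
      Matrix.transpose_transpose, Matrix.add_apply, Matrix.transpose_apply,
      mul_transpose_signedBlowup_apply hF, mul_transpose_signedBlowup_apply hF,
      hK.apply_comm (ρ i') (ρ i)]
    ring
  constructor
  · intro h
    have eq_of_ne (i i' : m) (hne : ρ i' ≠ ρ i) : R i = R i' := by
      have hunit := ((u i).isUnit.mul (u i').isUnit).mul (hK.isUnit_of_ne _ _ hne)
      have hprod := (entry i i').symm.trans (congrFun₂ h i i')
      exact sub_eq_zero.1 (hunit.mul_right_eq_zero.1 hprod)
    obtain ⟨r, t, hrt⟩ := exists_pair_ne ι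
    obtain ⟨i₀, rfl⟩ := hρ r
    obtain ⟨i₁, rfl⟩ := hρ t
    refine ⟨R i₀, fun i => ?_⟩
    by_cases hi : ρ i = ρ i₀
    · exact (eq_of_ne i i₁ (hi ▸ hrt.symm)).trans (eq_of_ne i₁ i₀ hrt)
    · exact eq_of_ne i i₀ (Ne.symm hi)
  · rintro ⟨x, hx⟩
    ext i i'
    rw [entry, show R i = x from hx i, show R i' = x from hx i', sub_self, mul_zero,
      Matrix.zero_apply]

theorem transpose_mul_signedBlowup_skew_iff [Fintype m] [Nontrivial ι] (hK : IsSkewSeidel K)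
    (hσ : σ.Surjective) (hF : ∀ i j, ρ i ≠ σ j → F i j = 0) :
    Fᵀ * signedBlowup K ρ σ u v + (signedBlowup K ρ σ u v)ᵀ * F = 0 ↔
      ∃ y : ℤ, ∀ j, ∑ i, signTwist u v F i j = y := by
  have h := mul_transpose_signedBlowup_skew_iff (u := v) (v := u) (F := Fᵀ) hK.transpose hσ
    fun j i hij => hF i j hij.symm
  rwa [← transpose_signedBlowup, Matrix.transpose_transpose, Matrix.transpose_transpose,
    ← transpose_signTwist] at h

variable [Fintype m] [Fintype n] [Nontrivial ι]

theorem gram_signedBlowup_iff (hK : IsSkewSeidel K) (hρ : ρ.Surjective) (hσ : σ.Surjective) :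
    (IsSignComplement (signedBlowup K ρ σ u v) F ∧
        F * (signedBlowup K ρ σ u v)ᵀ + signedBlowup K ρ σ u v * Fᵀ = 0 ∧
        Fᵀ * signedBlowup K ρ σ u v + (signedBlowup K ρ σ u v)ᵀ * F = 0) ↔
      ∃ x y, IsBlockSignMatrix ρ σ (signTwist u v F) x y := by
  rw [isSignComplement_signedBlowup_iff hK]
  constructor
  · rintro ⟨⟨hunit, hzero⟩, hrows, hcols⟩
    obtain ⟨x, hx⟩ := (mul_transpose_signedBlowup_skew_iff hK hρ hzero).1 hrows
    obtain ⟨y, hy⟩ := (transpose_mul_signedBlowup_skew_iff hK hσ hzero).1 hcols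
    exact ⟨x, y, fun i j h => isUnit_signTwist_apply_iff.2 (hunit i j h),
      fun i j h => signTwist_apply_eq_zero_iff.2 (hzero i j h), hx, hy⟩
  · rintro ⟨x, y, hG⟩
    have hzero (i : m) (j : n) (h : ρ i ≠ σ j) : F i j = 0 :=
      signTwist_apply_eq_zero_iff.1 (hG.eq_zero i j h)
    exact ⟨⟨fun i j h => isUnit_signTwist_apply_iff.1 (hG.isUnit i j h), hzero⟩,
      (mul_transpose_signedBlowup_skew_iff hK hρ hzero).2 ⟨x, hG.row_sum⟩,
      (transpose_mul_signedBlowup_skew_iff hK hσ hzero).2 ⟨y, hG.col_sum⟩⟩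

theorem isRealizable_signedBlowup_iff_exists_isSignMatrix [DecidableEq ι] (hK : IsSkewSeidel K)
    (hρ : ρ.Surjective) (hσ : σ.Surjective) (hrow : signedBlowup K ρ σ u v *ᵥ 1 = 0)
    (hcol : 1 ᵥ* signedBlowup K ρ σ u v = 0) :
    IsRealizable (signedBlowup K ρ σ u v) ↔
      ∃ x y : ℤ, ∀ r, ∃ G : Matrix {i // ρ i = r} {j // σ j = r} ℤ, IsSignMatrix G x y := by
  simp only [isRealizable_iff_exists_isSignComplement (signedBlowup_ne_zero hK hρ hσ) hrow hcol,
    gram_signedBlowup_iff hK hρ hσ, ← exists_isBlockSignMatrix_iff]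
  rw [← (signTwist_involutive u v).surjective.exists
    (p := fun G => ∃ x y, IsBlockSignMatrix ρ σ G x y)]
  exact ⟨fun ⟨G, x, y, hG⟩ => ⟨x, y, G, hG⟩, fun ⟨x, y, G, hG⟩ => ⟨G, x, y, hG⟩⟩

theorem mainTheorem7_general [DecidableEq ι] (hK : IsSkewSeidel K)
    (hρ : ρ.Surjective) (hσ : σ.Surjective) (hrow : signedBlowup K ρ σ u v *ᵥ 1 = 0)
    (hcol : 1 ᵥ* signedBlowup K ρ σ u v = 0) :
    IsRealizable (signedBlowup K ρ σ u v) ↔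
      ((∀ r, Even (Fintype.card {i // ρ i = r})) ∧ ∀ r, Even (Fintype.card {j // σ j = r})) ∨
        (((∀ r, Odd (Fintype.card {i // ρ i = r})) ∨
            ∀ r, Odd (Fintype.card {j // σ j = r})) ∧
          ∀ r t, (Fintype.card {j // σ j = r} : ℚ) / Fintype.card {i // ρ i = r} =
            (Fintype.card {j // σ j = t} : ℚ) / Fintype.card {i // ρ i = t}) := by
  have hρ_fiber (r : ι) : Nonempty {i // ρ i = r} := nonempty_subtype.2 (hρ r)
  have hσ_fiber (r : ι) : Nonempty {j // σ j = r} := nonempty_subtype.2 (hσ r)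
  have hcard (r : ι) : (Fintype.card {i // ρ i = r} : ℚ) ≠ 0 :=
    Nat.cast_ne_zero.2 Fintype.card_ne_zero
  rw [isRealizable_signedBlowup_iff_exists_isSignMatrix hK hρ hσ hrow hcol,
    exists_forall_isSignMatrix_iff]
  simp only [div_eq_div_iff (hcard _) (hcard _), ← Nat.cast_mul, Nat.cast_inj]

end SignedBlowup

section FormM5

/-- The skew Seidel matrix of the cyclic tournament on three vertices. A matrix of form (M5) is a
blow-up of it. -/
def cyclicTournament : Matrix (Fin 3) (Fin 3) ℤ := Matrix.circulant ![0, -1, 1]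

theorem isSkewSeidel_cyclicTournament : IsSkewSeidel cyclicTournament where
  transpose_eq_neg := by decide
  isUnit_of_ne r t h := by
    have isUnit_of_ne_zero : ∀ z : Fin 3, z ≠ 0 → IsUnit ((![0, -1, 1] : Fin 3 → ℤ) z) := by
      decide
    exact isUnit_of_ne_zero (r - t) (sub_ne_zero.2 h)

/-- The label in `Fin 3` of each of the six row blocks of a matrix of form (M5). -/
def rowLabelM5 : Fin 6 → Fin 3 := ![0, 0, 1, 1, 2, 2]

/-- The label in `Fin 3` of each of the six column blocks of a matrix of form (M5), in descending
order because the zero blocks of (M5) lie on the antidiagonal. -/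
def colLabelM5 : Fin 6 → Fin 3 := ![2, 2, 1, 1, 0, 0]

/-- The signs of the six row blocks which, with `colSignM5`, turn the sign pattern of (M5) into
`cyclicTournament`. -/
def rowSignM5 : Fin 6 → ℤˣ := ![1, -1, -1, 1, -1, 1]

/-- The signs of the six column blocks which, with `rowSignM5`, turn the sign pattern of (M5) into
`cyclicTournament`. -/
def colSignM5 : Fin 6 → ℤˣ := ![-1, 1, 1, -1, 1, -1]

theorem signPatternM5_eq_signedBlowup :
    signPatternM5 =
      signedBlowup cyclicTournament rowLabelM5 colLabelM5 rowSignM5 colSignM5 := by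
  decide

theorem matrixM5_eq_signedBlowup (k l p q r s a b c d e f : ℕ) :
    matrixM5 k l p q r s a b c d e f =
      signedBlowup cyclicTournament (fun x => rowLabelM5 x.1) (fun y => colLabelM5 y.1)
        (fun x => rowSignM5 x.1) fun y => colSignM5 y.1 := by
  rw [matrixM5, signPatternM5_eq_signedBlowup]
  rfl

theorem card_rowLabelM5_fiber (k l p q r s : ℕ) (t : Fin 3) :
    Fintype.card {x : BlockIndex ![k, l, p, q, r, s] // rowLabelM5 x.1 = t} =
      ![k + l, p + q, r + s] t := by
  rw [card_fiber_sigma_fst]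
  fin_cases t <;> simp [Fin.sum_univ_six, rowLabelM5]

theorem card_colLabelM5_fiber (a b c d e f : ℕ) (t : Fin 3) :
    Fintype.card {y : BlockIndex ![a, b, c, d, e, f] // colLabelM5 y.1 = t} =
      ![e + f, c + d, a + b] t := by
  rw [card_fiber_sigma_fst]
  fin_cases t <;> simp [Fin.sum_univ_six, colLabelM5]

end FormM5

theorem mainTheorem7 (k l p q r s a b c d e f : ℕ)
    (hab : 0 < a + b) (hcd : 0 < c + d) (hef : 0 < e + f)
    (hkl : 0 < k + l) (hpq : 0 < p + q) (hrs : 0 < r + s)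
    (hrow : matrixM5 k l p q r s a b c d e f *ᵥ 1 = 0)
    (hcol : 1 ᵥ* matrixM5 k l p q r s a b c d e f = 0) :
    IsRealizable (matrixM5 k l p q r s a b c d e f) ↔
      (Even (a + b) ∧ Even (c + d) ∧ Even (e + f) ∧
          Even (k + l) ∧ Even (p + q) ∧ Even (r + s)) ∨
        (((Odd (a + b) ∧ Odd (c + d) ∧ Odd (e + f)) ∨
            (Odd (k + l) ∧ Odd (p + q) ∧ Odd (r + s))) ∧
          ((e : ℚ) + f) / ((k : ℚ) + l) = ((c : ℚ) + d) / ((p : ℚ) + q) ∧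
          ((c : ℚ) + d) / ((p : ℚ) + q) = ((a : ℚ) + b) / ((r : ℚ) + s)) := by
  have hrows := card_rowLabelM5_fiber k l p q r s
  have hcols := card_colLabelM5_fiber a b c d e f
  have hρ := surjective_of_card_fiber_pos fun t => by
    rw [hrows t]; fin_cases t <;> assumption
  have hσ := surjective_of_card_fiber_pos fun t => by
    rw [hcols t]; fin_cases t <;> assumption
  rw [matrixM5_eq_signedBlowup] at hrow hcol ⊢
  rw [mainTheorem7_general isSkewSeidel_cyclicTournament hρ hσ hrow hcol]
  simp only [hrows, hcols, Fin.forall_fin_succ, Fin.succ_zero_eq_one, Fin.succ_one_eq_two,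
    IsEmpty.forall_iff, and_true, Matrix.cons_val, Nat.cast_add]
  grind
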